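/- Online prediction with horizon $T\ge 1$: let $\mathcal X$ be a set of contexts, $B$ a real number, and $\mathcal H$ a nonempty finite set of functions $h:\mathcal X\to\mathbb R$ with $|h(x)|\le B$ for all $x$. The learner, who knows $T$, $|\mathcal H|$ and $B$, fixes an integer $m\ge 1$. In each round $t=1,\dots,T$ an adversary chooses, as an arbitrary function of the past rounds $(x_s,y_s,p_s)_{s<t}$, a context $x_t\in\mathcal X$ and a label $y_t\in[0,1]$; the learner, who is given $x_t$ (through the values $h(x_t)$, $h\in\mathcal H$) but not $y_t$, chooses a probability distribution $w_t$ on $\mathcal P=\{0,\frac1m,\dots,1\}$; a forecast $p_t$ is drawn from $w_t$; and then $y_t$ and $p_t$ are revealed to the learner. The online $\ell_1$-multicalibration error of the transcript $\pi_T=(x_t,y_t,p_t)_{t\le T}$ is $$K(\pi_T,\mathcal H)=\max_{h\in\mathcal H}\ \sum_{p\in\mathcal P}\frac1T\Big|\sum_{t\le T:\,p_t=p}h(x_t)\,(y_t-p_t)\Big| .$$ **Theorem.** There are a single learning algorithm and universal constants $C,c,k$ such that for all $\mathcal X,\mathcal H,B,T$ as above and every adaptive adversary, $$\mathbb E[K(\pi_T,\mathcal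 H)]\ \le\ C\,B\,T^{-1/3}\sqrt{\log(6T|\mathcal H|)} ,$$ and the total running time of the algorithm over the $T$ rounds is always at most $c\,|\mathcal H|\,T^{k}$, i.e. linear in $|\mathcal H|$ and polynomial in $T$. Running time is counted on a real RAM: arithmetic operations and comparisons of reals, additions and subtractions of integer counters and addresses, memory accesses, and evaluations $h(x_t)$ of a function $h\in\mathcal H$ at the current context cost one step each, and drawing $p_t$ from $w_t$ costs $m+1$ steps. -/

import Mathlib

namespace OnlineMulticalibration

/-! ### Online prediction: transcripts, adversaries, expected multicalibration error -/

/-- One round of a transcript on the forecast grid `{0, 1/m, …, 1}`: the context, the label in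
`[0, 1]`, and the index `p` of the forecast, whose value is `p / m`. -/
structure Round (X : Type*) (m : ℕ) where
  x : X
  y : unitInterval
  p : Fin (m + 1)

/-- An adaptive adversary chooses the next context and label from the transcript so far
(earlier rounds first). -/
abbrev Adversary (X : Type*) (m : ℕ) := List (Round X m) → X × unitInterval

/-- A randomized forecaster: from the transcript so far and the current context it determines the
weights `w 0, …, w m` with which the forecasts `0, 1/m, …, 1` are drawn. -/
abbrev Forecaster (X : Type*) (m : ℕ) := List (Round X m) → X → Fin (m + 1) → ℝ

/-- Online `ℓ₁`-multicalibration error of a transcript (of horizon `T = π.length`)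
with respect to `h`. -/
noncomputable def multicalError {X : Type*} {m : ℕ} (π : List (Round X m)) (h : X → ℝ) : ℝ :=
  ∑ i : Fin (m + 1), 1 / (π.length : ℝ) *
    |((π.filter (fun r => r.p = i)).map
      (fun r => h r.x * ((r.y : ℝ) - (r.p : ℕ) / (m : ℝ)))).sum|

/-- Online `ℓ₁`-multicalibration error of a transcript with respect to a finite class. -/
noncomputable def multicalErrorClass {X : Type*} {m : ℕ} (π : List (Round X m))
    (H : Finset (X → ℝ)) (hH : H.Nonempty) : ℝ :=
  H.sup' hH (multicalError π)

/-- `expect F A g n π` is the expectation of `g` (final transcript) when `n` more rounds are played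
after the transcript `π`: in each round the adversary picks a context and a label from the
transcript, then the forecast is drawn from the weights of the forecaster, which sees the
transcript and the context but not the label. -/
noncomputable def expect {X : Type*} {m : ℕ} (F : Forecaster X m) (A : Adversary X m)
    (g : List (Round X m) → ℝ) : ℕ → List (Round X m) → ℝ
  | 0, π => g π
  | n + 1, π => ∑ i : Fin (m + 1),
      F π (A π).1 i * expect F A g n (π ++ [⟨(A π).1, (A π).2, i⟩])

/-! ### Real-RAM programs with a step count -/

/-- Memory: natural-number registers (used for counting and addressing), real registers, and
real arrays. -/
structure State where
  nreg : ℕ → ℕ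
  rreg : ℕ → ℝ
  mem : ℕ → ℕ → ℝ

/-- Commands of a real RAM. Arithmetic on natural numbers is restricted to addition and truncated
subtraction, and there is no conversion of reals to integers. Control flow consists of branching
on a comparison of reals and of loops whose number of iterations is read from a register, so
that every command halts. -/
inductive Cmd where
  /-- `n_d := k` -/
  | setN (d k : ℕ)
  /-- `n_d := n_a + n_b` -/
  | addN (d a b : ℕ)
  /-- `n_d := n_a - n_b`, truncated at `0` -/
  | subN (d a b : ℕ)
  /-- `r_d := n_a` -/
  | castN (d a : ℕ)
  /-- `r_d := r_a + r_b` -/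
  | add (d a b : ℕ)
  /-- `r_d := r_a - r_b` -/
  | sub (d a b : ℕ)
  /-- `r_d := r_a * r_b` -/
  | mul (d a b : ℕ)
  /-- `r_d := r_a / r_b`, with value `0` if `r_b = 0` -/
  | div (d a b : ℕ)
  /-- `r_d := mem_A[n_i]` -/
  | load (d A i : ℕ)
  /-- `mem_A[n_i] := r_a` -/
  | store (A i a : ℕ)
  /-- `r_d :=` value at the current context of the function with index `n_i` -/
  | query (d i : ℕ)
  /-- do nothing -/
  | skip
  /-- sequential composition -/
  | seq (c c' : Cmd)
  /-- `if r_a < r_b then c else c'` -/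
  | ifLt (a b : ℕ) (c c' : Cmd)
  /-- repeat `c`, as many times as the value of `n_i` on entry -/
  | loop (i : ℕ) (c : Cmd)

namespace State

def setNat (s : State) (d v : ℕ) : State :=
  { s with nreg := Function.update s.nreg d v }

noncomputable def setReal (s : State) (d : ℕ) (v : ℝ) : State :=
  { s with rreg := Function.update s.rreg d v }

noncomputable def setMem (s : State) (A i : ℕ) (v : ℝ) : State :=
  { s with mem := Function.update s.mem A (Function.update (s.mem A) i v) }

end State

/-- Execution of a command: the final state and the number of steps. Every elementary command,
every branching, and every iteration of a loop (besides its body) costs one step. The values of the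
functions at the current context are given by `o`. -/
noncomputable def Cmd.exec (o : ℕ → ℝ) : Cmd → State → State × ℕ
  | .setN d k, s => (s.setNat d k, 1)
  | .addN d a b, s => (s.setNat d (s.nreg a + s.nreg b), 1)
  | .subN d a b, s => (s.setNat d (s.nreg a - s.nreg b), 1)
  | .castN d a, s => (s.setReal d (s.nreg a : ℝ), 1)
  | .add d a b, s => (s.setReal d (s.rreg a + s.rreg b), 1)
  | .sub d a b, s => (s.setReal d (s.rreg a - s.rreg b), 1)
  | .mul d a b, s => (s.setReal d (s.rreg a * s.rreg b), 1)
  | .div d a b, s => (s.setReal d (s.rreg a / s.rreg b), 1)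
  | .load d A i, s => (s.setReal d (s.mem A (s.nreg i)), 1)
  | .store A i a, s => (s.setMem A (s.nreg i) (s.rreg a), 1)
  | .query d i, s => (s.setReal d (o (s.nreg i)), 1)
  | .skip, s => (s, 1)
  | .seq c c', s =>
      let u := c.exec o s
      let v := c'.exec o u.1
      (v.1, u.2 + v.2)
  | .ifLt a b c c', s =>
      let u := if s.rreg a < s.rreg b then c.exec o s else c'.exec o s
      (u.1, u.2 + 1)
  | .loop i c, s =>
      (fun q : State × ℕ => ((c.exec o q.1).1, q.2 + (c.exec o q.1).2 + 1))^[s.nreg i] (s, 1)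

/-- A forecasting program: `setup` is executed once, `predict` after the arrival of each context,
and `learn` after the revelation of each label. -/
structure Program where
  setup : Cmd
  predict : Cmd
  learn : Cmd

/-- Initial memory: the horizon is in `n_0`, the number of functions in `n_1`, the bound in `r_0`,
and everything else is `0`. -/
noncomputable def initialState (T N : ℕ) (B : ℝ) : State where
  nreg := fun i => if i = 0 then T else if i = 1 then N else 0
  rreg := fun i => if i = 0 then B else 0
  mem := fun _ _ => 0

/-- The values of the functions `h 0, …, h (N - 1)` at the context `x`. -/
noncomputable def valuesAt {X : Type*} {N : ℕ} (h : Fin N → X → ℝ) (x : X) : ℕ → ℝ :=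
  fun j => if hj : j < N then h ⟨j, hj⟩ x else 0

namespace Program

/-- State and step count after the setup (no context is available yet). -/
noncomputable def start (P : Program) (T N : ℕ) (B : ℝ) : State × ℕ :=
  P.setup.exec (fun _ => 0) (initialState T N B)

/-- The discretization parameter chosen by the program: the content of `n_2` after the setup. -/
noncomputable def discretization (P : Program) (T N : ℕ) (B : ℝ) : ℕ :=
  (P.start T N B).1.nreg 2

/-- One round. The program runs `predict`; then the forecast is drawn from the `m + 1` weights
it has written, at a cost of `m + 1` steps; then the index of the forecast is put into `n_3`, the
label into `r_1`, and `learn` is executed. -/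
noncomputable def step (P : Program) {X : Type*} {N m : ℕ} (h : Fin N → X → ℝ)
    (q : State × ℕ) (r : Round X m) : State × ℕ :=
  let u := P.predict.exec (valuesAt h r.x) q.1
  let v := P.learn.exec (valuesAt h r.x) ((u.1.setNat 3 r.p).setReal 1 r.y)
  (v.1, q.2 + u.2 + (m + 1) + v.2)

/-- State and total number of steps after a transcript, setup included. -/
noncomputable def run (P : Program) (T : ℕ) (B : ℝ) {X : Type*} {N m : ℕ} (h : Fin N → X → ℝ)
    (π : List (Round X m)) : State × ℕ :=
  π.foldl (P.step h) (P.start T N B)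

/-- The forecaster implemented by the program: after `predict` the weight of the forecast `i / m`
is the content of `mem_0[i]`. -/
noncomputable def forecaster (P : Program) (T : ℕ) (B : ℝ) {X : Type*} {N : ℕ} (m : ℕ)
    (h : Fin N → X → ℝ) : Forecaster X m :=
  fun π x i => (P.predict.exec (valuesAt h x) (P.run T B h π).1).1.mem 0 i

end Program

end OnlineMulticalibration

open OnlineMulticalibration

namespace OnlineMulticalibration

/-! ### Stopping a scan of the forecast grid -/

/-! For a fixed `h`, the sum of absolute values in the error is a maximum over sign vectors indexed
by the grid. Give each sign vector a gambler who bets the fraction `±s` on every residual `h x * (y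
- p)`, with the sign attached to `p`. The average wealth of these `2 ^ (m + 1)` gamblers factors
over the grid into means of two wealths (`totalWealth`), so keeping track of it costs only `m + 1`
numbers per function. A gambler with the right signs turns a large error into exponentially large
wealth, so `s * T * error` is at most `(m + 1) log 2 + log totalWealth + T ε ^ 2`, where `ε` bounds
`|s * h x|` (`mul_multicalError_le`).

The potential sums `totalWealth` over the class. Since wealth is affine in each residual, a round
changes the potential by exactly `s * (y - p) * G p`, with `G` the gradient, known before `y`
(`potential_append`). The learner hedges against every `y` at once: it stays at `0` if `G 0 ≤ 0`,
goes to `1` if `G` is positive on the whole grid, and otherwise mixes two neighbours at the first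
sign change so that `G` has mean zero. Then `y` cancels and only the grid spacing `1 / m` is lost
(`sum_stopWeight_mul_le`), so the expected potential grows by a factor of at most `1 + ε / m` per
round.

Bounding the logarithm by a tangent line and taking expectations (`expect_le_of_step`) gives the
error bound `B * (2m(m + 1 + log N) / T + 1 / m + 1 / (2m))` for `ε = 1 / (2m)`; the choice `m ≈ T ^
(1/3)` balances it. The program stores only advantages and total wealths, which have closed update
rules (`advantage_append`, `totalWealth_append`). A round costs `O(m N)` steps. -/

/-- The fraction of the mass at a grid point with value `a` that moves on to the next grid point,
with value `b`. -/
noncomputable def moveFraction (a b : ℝ) : ℝ :=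
  if 0 < a then (if 0 < b then 1 else a / (a - b)) else 0

/-- The mass that arrives at the `k`-th grid point. -/
noncomputable def reach (G : ℕ → ℝ) : ℕ → ℝ
  | 0 => 1
  | k + 1 => reach G k * moveFraction (G k) (G (k + 1))

/-- The mass that stays at the `k`-th of the grid points `0, …, m`. -/
noncomputable def stopWeight (G : ℕ → ℝ) (m k : ℕ) : ℝ :=
  if k = m then reach G k else reach G k - reach G (k + 1)

lemma moveFraction_nonneg (a b : ℝ) : 0 ≤ moveFraction a b := by
  unfold moveFraction
  split_ifs with h1 h2
  · exact zero_le_one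
  · exact div_nonneg h1.le (by linarith)
  · exact le_rfl

lemma moveFraction_le_one (a b : ℝ) : moveFraction a b ≤ 1 := by
  unfold moveFraction
  split_ifs with h1 h2
  · exact le_rfl
  · rw [div_le_one (by linarith)]
    linarith
  · exact zero_le_one

lemma reach_nonneg (G : ℕ → ℝ) (k : ℕ) : 0 ≤ reach G k := by
  induction k with
  | zero => exact zero_le_one
  | succ k ih => exact mul_nonneg ih (moveFraction_nonneg _ _)

lemma stopWeight_nonneg (G : ℕ → ℝ) (m k : ℕ) : 0 ≤ stopWeight G m k := by
  unfold stopWeight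
  split_ifs
  · exact reach_nonneg G k
  · have := mul_le_mul_of_nonneg_left (moveFraction_le_one (G k) (G (k + 1))) (reach_nonneg G k)
    simp only [reach]
    linarith

lemma sum_stopWeight_mul (G f : ℕ → ℝ) (m : ℕ) :
    ∑ k ∈ Finset.range (m + 1), stopWeight G m k * f k =
      ∑ k ∈ Finset.range m, (reach G k - reach G (k + 1)) * f k + reach G m * f m := by
  rw [Finset.sum_range_succ]
  congr 1
  · refine Finset.sum_congr rfl fun k hk => ?_
    rw [stopWeight, if_neg (Finset.mem_range.1 hk).ne]
  · rw [stopWeight, if_pos rfl]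

lemma sum_stopWeight (G : ℕ → ℝ) (m : ℕ) :
    ∑ k ∈ Finset.range (m + 1), stopWeight G m k = 1 := by
  have h := sum_stopWeight_mul G (fun _ => 1) m
  simp only [mul_one] at h
  rw [h, Finset.sum_range_sub']
  simp [reach]

lemma sum_stopWeight_mul_le {G : ℕ → ℝ} {m : ℕ} {M y : ℝ} (hm : 1 ≤ m)
    (hG : ∀ k, k ≤ m → |G k| ≤ M) (hy0 : 0 ≤ y) (hy1 : y ≤ 1) :
    ∑ k ∈ Finset.range (m + 1), stopWeight G m k * ((y - k / m) * G k) ≤ M / m := by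
  have hm0 : (0 : ℝ) < m := by exact_mod_cast hm
  have hM : 0 ≤ M := (abs_nonneg _).trans (hG 0 (Nat.zero_le m))
  -- Scan invariant: either all the mass has reached `k`, `G k` is positive and nothing has been
  -- paid, or the mass at `k` goes no further and the final bound already holds.
  have key : ∀ k, k ≤ m →
      (reach G k = 1 ∧ 0 < G k ∧
        ∑ i ∈ Finset.range k, (reach G i - reach G (i + 1)) * ((y - i / m) * G i) = 0) ∨
      ((reach G k = 0 ∨ G k ≤ 0) ∧
        ∑ i ∈ Finset.range k, (reach G i - reach G (i + 1)) * ((y - i / m) * G i) +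
          reach G k * ((y - k / m) * G k) ≤ M / m) := by
    intro k
    induction k with
    | zero =>
      intro _
      by_cases h : 0 < G 0
      · exact Or.inl ⟨rfl, h, by simp⟩
      · refine Or.inr ⟨Or.inr (not_lt.1 h), ?_⟩
        have h1 : y * G 0 ≤ 0 := mul_nonpos_of_nonneg_of_nonpos hy0 (not_lt.1 h)
        have h2 : 0 ≤ M / m := div_nonneg hM hm0.le
        simpa [reach] using h1.trans h2
    | succ k ih =>
      intro hk
      rcases ih (by omega) with ⟨h1, h2, h3⟩ | ⟨h1, h2⟩
      · by_cases h : 0 < G (k + 1)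
        · have hr : reach G (k + 1) = 1 := by simp [reach, moveFraction, h1, h2, h]
          refine Or.inl ⟨hr, h, ?_⟩
          rw [Finset.sum_range_succ, h3, hr, h1]
          simp
        · refine Or.inr ⟨Or.inr (not_lt.1 h), ?_⟩
          have hr : reach G (k + 1) = G k / (G k - G (k + 1)) := by
            simp [reach, moveFraction, h1, h2, h]
          have hd : 0 < G k - G (k + 1) := by linarith [not_lt.1 h]
          rw [Finset.sum_range_succ, h3, h1]
          have hle : reach G (k + 1) ≤ 1 := by
            rw [hr, div_le_one hd]
            linarith [not_lt.1 h]
          -- The split at the sign change makes the mean of `G` vanish, which removes `y`; what is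
          -- left comes from the two forecasts differing by `1 / m`.
          have hbal : (1 - reach G (k + 1)) * G k + reach G (k + 1) * G (k + 1) = 0 := by
            rw [hr]
            field_simp
            ring
          have hM' : -G (k + 1) ≤ M := (neg_le_abs _).trans (hG (k + 1) hk)
          have hb : reach G (k + 1) * (-G (k + 1)) ≤ M := by
            have := mul_le_mul_of_nonneg_right hle (neg_nonneg.2 (not_lt.1 h))
            linarith
          calc 0 + (1 - reach G (k + 1)) * ((y - k / m) * G k) +
                reach G (k + 1) * ((y - (k + 1 : ℕ) / m) * G (k + 1))
              = (y - k / m) *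
                  ((1 - reach G (k + 1)) * G k + reach G (k + 1) * G (k + 1)) +
                  reach G (k + 1) * (-G (k + 1)) / m := by
                push_cast
                ring
            _ = reach G (k + 1) * (-G (k + 1)) / m := by rw [hbal]; ring
            _ ≤ M / m := by gcongr
      · have hr : reach G (k + 1) = 0 := by
          rcases h1 with h1 | h1
          · simp [reach, h1]
          · simp [reach, moveFraction, not_lt.2 h1]
        refine Or.inr ⟨Or.inl hr, ?_⟩
        rw [Finset.sum_range_succ, hr]
        linarith
  rw [sum_stopWeight_mul G (fun k => (y - k / m) * G k) m]
  rcases key m le_rfl with ⟨h1, h2, h3⟩ | ⟨-, h⟩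
  · rw [h1, h3, div_self hm0.ne']
    have h4 : (y - 1) * G m ≤ 0 := mul_nonpos_of_nonpos_of_nonneg (by linarith) h2.le
    have h5 : 0 ≤ M / m := div_nonneg hM hm0.le
    linarith
  · exact h

/-! ### Wealth processes and the potential -/

/-- An exponential lower bound for the factors of a wealth process. -/
lemma exp_sub_sq_le {z : ℝ} (hz : |z| ≤ 1 / 2) : Real.exp (z - z ^ 2) ≤ 1 + z := by
  obtain ⟨h1, h2⟩ := abs_le.1 hz
  rcases le_total 0 z with h | h
  · have h3 : 0 < 1 - (z - z ^ 2) := by nlinarith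
    have h4 : 1 - (z - z ^ 2) ≤ Real.exp (-(z - z ^ 2)) := by
      have := Real.add_one_le_exp (-(z - z ^ 2))
      linarith
    rw [← inv_inv (Real.exp _), ← Real.exp_neg]
    refine (inv_anti₀ h3 h4).trans ?_
    rw [inv_le_iff_one_le_mul₀ h3]
    nlinarith [pow_nonneg h 3]
  · obtain ⟨a, rfl⟩ : ∃ a, z = -a := ⟨-z, by ring⟩
    have ha : 0 ≤ a := by linarith
    have ha' : a ≤ 1 / 2 := by linarith
    -- The quadratic term is needed: `(1 - a) * (1 + a + a ^ 2) = 1 - a ^ 3` falls short of `1`.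
    have h3 : 1 + (a + a ^ 2) + (a + a ^ 2) ^ 2 / 2 ≤ Real.exp (a + a ^ 2) :=
      Real.quadratic_le_exp_of_nonneg (by positivity)
    have h4 : 0 < 1 + (a + a ^ 2) + (a + a ^ 2) ^ 2 / 2 := by positivity
    have h5 : -a - (-a) ^ 2 = -(a + a ^ 2) := by ring
    rw [h5, Real.exp_neg]
    refine (inv_anti₀ h4 h3).trans ?_
    rw [inv_le_iff_one_le_mul₀ h4]
    have h6 : 0 ≤ 1 - a - a ^ 2 - a ^ 3 := by
      have : a ^ 2 ≤ 1 / 4 := by nlinarith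
      have : a ^ 3 ≤ 1 / 8 := by nlinarith
      linarith
    nlinarith [mul_nonneg (sq_nonneg a) h6]

variable {X : Type*} {m : ℕ}

/-- The summand of a round in the multicalibration error with respect to `h`. -/
noncomputable def Round.residual (r : Round X m) (h : X → ℝ) : ℝ :=
  h r.x * ((r.y : ℝ) - (r.p : ℕ) / (m : ℝ))

/-- The wealth of a gambler who bets the fraction `s` on the residuals of the rounds with
forecast `p`. -/
noncomputable def wealth (s : ℝ) (h : X → ℝ) (π : List (Round X m)) (p : ℕ) : ℝ :=
  ((π.filter (fun r => (r.p : ℕ) = p)).map (fun r => 1 + s * r.residual h)).prod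

/-- The mean wealth of two gamblers who bet `s` and `-s`. -/
noncomputable def meanWealth (s : ℝ) (h : X → ℝ) (π : List (Round X m)) (p : ℕ) : ℝ :=
  (wealth s h π p + wealth (-s) h π p) / 2

/-- The relative advantage of the gambler who bets `s` over the one who bets `-s`. -/
noncomputable def advantage (s : ℝ) (h : X → ℝ) (π : List (Round X m)) (p : ℕ) : ℝ :=
  (wealth s h π p - wealth (-s) h π p) / (wealth s h π p + wealth (-s) h π p)

/-- The mean wealth over all choices of a sign for each forecast. -/
noncomputable def totalWealth (s : ℝ) (h : X → ℝ) (π : List (Round X m)) : ℝ :=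
  ∏ p ∈ Finset.range (m + 1), meanWealth s h π p

/-- The sum of the mean wealths over a family of functions. -/
noncomputable def potential {N : ℕ} (s : ℝ) (h : Fin N → X → ℝ) (π : List (Round X m)) : ℝ :=
  ∑ j, totalWealth s (h j) π

/-- The rate at which the potential changes with the residual of a forecast `p` at `x`. -/
noncomputable def gradient {N : ℕ} (s : ℝ) (h : Fin N → X → ℝ) (π : List (Round X m)) (x : X)
    (p : ℕ) : ℝ :=
  ∑ j, h j x * advantage s (h j) π p * totalWealth s (h j) π

lemma abs_label_sub_le (r : Round X m) : |(r.y : ℝ) - (r.p : ℕ) / (m : ℝ)| ≤ 1 := by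
  have h0 := r.y.2.1
  have h1 := r.y.2.2
  have h2 : (0 : ℝ) ≤ (r.p : ℕ) / (m : ℝ) := by positivity
  have h3 : ((r.p : ℕ) : ℝ) / (m : ℝ) ≤ 1 := by
    apply div_le_one_of_le₀ _ (Nat.cast_nonneg m)
    exact_mod_cast Nat.lt_succ_iff.1 r.p.2
  rw [abs_le]
  constructor <;> linarith

lemma abs_residual_le {h : X → ℝ} {B : ℝ} (hB : ∀ x, |h x| ≤ B) (r : Round X m) :
    |r.residual h| ≤ B := by
  rw [Round.residual, abs_mul]
  have h1 := mul_le_mul_of_nonneg_left (abs_label_sub_le r) (abs_nonneg (h r.x))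
  linarith [hB r.x]

lemma abs_mul_residual_le {h : X → ℝ} {s ε : ℝ} (hs : ∀ x, |s * h x| ≤ ε) (r : Round X m) :
    |s * r.residual h| ≤ ε := by
  have h1 := abs_residual_le (h := fun x => s * h x) hs r
  rwa [Round.residual, mul_assoc] at h1

lemma wealth_nil (s : ℝ) (h : X → ℝ) (p : ℕ) : wealth (m := m) s h [] p = 1 := by
  simp [wealth]

lemma wealth_append (s : ℝ) (h : X → ℝ) (π : List (Round X m)) (r : Round X m) (p : ℕ) :
    wealth s h (π ++ [r]) p =
      if (r.p : ℕ) = p then wealth s h π p * (1 + s * r.residual h) else wealth s h π p := by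
  unfold wealth
  split_ifs with hp <;> simp [List.filter_append, hp]

/-- Multiply `exp (z - z ^ 2) ≤ 1 + z` over the rounds with forecast `p`; each round loses at most
`ε ^ 2` in the exponent. -/
lemma exp_le_wealth {h : X → ℝ} {s ε : ℝ} (hε : ε ≤ 1 / 2) (hs : ∀ x, |s * h x| ≤ ε)
    (π : List (Round X m)) (p : ℕ) :
    Real.exp (s * ((π.filter (fun r => (r.p : ℕ) = p)).map (fun r => r.residual h)).sum -
      (π.filter (fun r => (r.p : ℕ) = p)).length * ε ^ 2) ≤ wealth s h π p := by
  unfold wealth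
  induction π.filter (fun r => (r.p : ℕ) = p) with
  | nil => simp
  | cons r l ih =>
    have h1 := abs_mul_residual_le hs r
    have h2 := exp_sub_sq_le (h1.trans hε)
    have h3 : (s * r.residual h) ^ 2 ≤ ε ^ 2 := sq_le_sq' (abs_le.1 h1).1 (abs_le.1 h1).2
    rw [List.map_cons, List.sum_cons, List.map_cons, List.prod_cons, List.length_cons]
    calc _ ≤ Real.exp ((s * r.residual h - (s * r.residual h) ^ 2) +
          (s * (l.map (fun r => r.residual h)).sum - l.length * ε ^ 2)) := by
          apply Real.exp_le_exp.2
          push_cast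
          linarith
      _ ≤ _ := by
          rw [Real.exp_add]
          exact mul_le_mul h2 ih (Real.exp_nonneg _) ((Real.exp_nonneg _).trans h2)

lemma wealth_pos {h : X → ℝ} {s ε : ℝ} (hε : ε ≤ 1 / 2) (hs : ∀ x, |s * h x| ≤ ε)
    (π : List (Round X m)) (p : ℕ) : 0 < wealth s h π p :=
  (Real.exp_pos _).trans_le (exp_le_wealth hε hs π p)

lemma abs_neg_mul_le {h : X → ℝ} {s ε : ℝ} (hs : ∀ x, |s * h x| ≤ ε) (x : X) :
    |(-s) * h x| ≤ ε := by
  rw [neg_mul, abs_neg]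
  exact hs x

lemma meanWealth_pos {h : X → ℝ} {s ε : ℝ} (hε : ε ≤ 1 / 2) (hs : ∀ x, |s * h x| ≤ ε)
    (π : List (Round X m)) (p : ℕ) : 0 < meanWealth s h π p := by
  have h1 := wealth_pos hε hs π p
  have h2 := wealth_pos hε (abs_neg_mul_le hs) π p
  unfold meanWealth
  positivity

lemma totalWealth_pos {h : X → ℝ} {s ε : ℝ} (hε : ε ≤ 1 / 2) (hs : ∀ x, |s * h x| ≤ ε)
    (π : List (Round X m)) : 0 < totalWealth s h π :=
  Finset.prod_pos fun p _ => meanWealth_pos hε hs π p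

lemma abs_advantage_le {h : X → ℝ} {s ε : ℝ} (hε : ε ≤ 1 / 2) (hs : ∀ x, |s * h x| ≤ ε)
    (π : List (Round X m)) (p : ℕ) : |advantage s h π p| ≤ 1 := by
  have h1 := wealth_pos hε hs π p
  have h2 := wealth_pos hε (abs_neg_mul_le hs) π p
  rw [advantage, abs_div, abs_of_pos (add_pos h1 h2), div_le_one (add_pos h1 h2), abs_le]
  constructor <;> linarith

lemma advantage_nil (s : ℝ) (h : X → ℝ) (p : ℕ) : advantage (m := m) s h [] p = 0 := by
  simp [advantage, wealth_nil]

lemma totalWealth_nil (s : ℝ) (h : X → ℝ) : totalWealth (m := m) s h [] = 1 := by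
  simp [totalWealth, meanWealth, wealth_nil]

lemma meanWealth_append {h : X → ℝ} {s ε : ℝ} (hε : ε ≤ 1 / 2) (hs : ∀ x, |s * h x| ≤ ε)
    (π : List (Round X m)) (r : Round X m) (p : ℕ) :
    meanWealth s h (π ++ [r]) p =
      meanWealth s h π p *
        (if (r.p : ℕ) = p then 1 + s * r.residual h * advantage s h π p else 1) := by
  have h1 := wealth_pos hε hs π p
  have h2 := wealth_pos hε (abs_neg_mul_le hs) π p
  simp only [meanWealth, wealth_append, advantage]
  split_ifs
  · field_simp
    ring
  · ring

lemma one_add_mul_advantage_pos {h : X → ℝ} {s ε : ℝ} (hε : ε ≤ 1 / 2)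
    (hs : ∀ x, |s * h x| ≤ ε) (π : List (Round X m)) (r : Round X m) (p : ℕ) :
    0 < 1 + s * r.residual h * advantage s h π p := by
  have h1 := abs_mul_residual_le hs r
  have h2 := abs_advantage_le hε hs π p
  have h3 : |s * r.residual h * advantage s h π p| ≤ 1 / 2 * 1 := by
    rw [abs_mul]
    exact mul_le_mul (h1.trans hε) h2 (abs_nonneg _) (by norm_num)
  linarith [(abs_le.1 h3).1]

/-- The addition formula of `tanh`. It updates an advantage without access to the two wealths, and
its denominator is also the factor by which the total wealth changes. -/
lemma advantage_append {h : X → ℝ} {s ε : ℝ} (hε : ε ≤ 1 / 2) (hs : ∀ x, |s * h x| ≤ ε)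
    (π : List (Round X m)) (r : Round X m) (p : ℕ) :
    advantage s h (π ++ [r]) p =
      if (r.p : ℕ) = p then
        (advantage s h π p + s * r.residual h) / (1 + s * r.residual h * advantage s h π p)
      else advantage s h π p := by
  have h1 := wealth_pos hε hs π p
  have h2 := wealth_pos hε (abs_neg_mul_le hs) π p
  have h3 := wealth_pos hε hs (π ++ [r]) p
  have h4 := wealth_pos hε (abs_neg_mul_le hs) (π ++ [r]) p
  have h5 := one_add_mul_advantage_pos hε hs π r p
  by_cases hp : (r.p : ℕ) = p
  · rw [if_pos hp, eq_div_iff h5.ne', advantage, div_mul_eq_mul_div, div_eq_iff (add_pos h3 h4).ne']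
    simp only [wealth_append, if_pos hp, advantage]
    field_simp
    ring
  · simp only [if_neg hp, advantage, wealth_append]

lemma totalWealth_append {h : X → ℝ} {s ε : ℝ} (hε : ε ≤ 1 / 2) (hs : ∀ x, |s * h x| ≤ ε)
    (π : List (Round X m)) (r : Round X m) :
    totalWealth s h (π ++ [r]) =
      totalWealth s h π * (1 + s * r.residual h * advantage s h π r.p) := by
  simp only [totalWealth, meanWealth_append hε hs, Finset.prod_mul_distrib]
  rw [Finset.prod_ite_eq, if_pos (Finset.mem_range.2 r.p.2)]

/-- An identity rather than an estimate, because only the factor of the drawn forecast changes and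
it is affine in the residual. Second-order losses enter only when wealth is compared with the error.
-/
lemma potential_append {N : ℕ} {h : Fin N → X → ℝ} {s ε : ℝ} (hε : ε ≤ 1 / 2)
    (hs : ∀ j x, |s * h j x| ≤ ε) (π : List (Round X m)) (r : Round X m) :
    potential s h (π ++ [r]) =
      potential s h π + s * (((r.y : ℝ) - (r.p : ℕ) / (m : ℝ)) * gradient s h π r.x r.p) := by
  simp only [potential, gradient, Finset.mul_sum]
  rw [← Finset.sum_add_distrib]
  refine Finset.sum_congr rfl fun j _ => ?_
  rw [totalWealth_append hε (hs j), Round.residual]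
  ring

lemma abs_mul_gradient_le {N : ℕ} {h : Fin N → X → ℝ} {s ε : ℝ} (hε : ε ≤ 1 / 2)
    (hs : ∀ j x, |s * h j x| ≤ ε) (π : List (Round X m)) (x : X) (p : ℕ) :
    |s * gradient s h π x p| ≤ ε * potential s h π := by
  simp only [potential, gradient, Finset.mul_sum]
  refine (Finset.abs_sum_le_sum_abs _ _).trans (Finset.sum_le_sum fun j _ => ?_)
  have h1 := totalWealth_pos hε (hs j) π
  rw [← mul_assoc, ← mul_assoc, abs_mul, abs_mul, abs_of_pos h1]
  refine mul_le_mul_of_nonneg_right ?_ h1.le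
  have h2 := mul_le_mul (hs j x) (abs_advantage_le hε (hs j) π p) (abs_nonneg _)
    ((abs_nonneg _).trans (hs j x))
  linarith

/-- With the weights of the stopped scan of the gradient, the potential grows by a factor of at
most `1 + ε / m` in expectation. -/
lemma sum_stopWeight_mul_potential_le {N : ℕ} {h : Fin N → X → ℝ} {s ε : ℝ} (hs0 : 0 ≤ s)
    (hm : 1 ≤ m) (hε : ε ≤ 1 / 2) (hs : ∀ j x, |s * h j x| ≤ ε) (π : List (Round X m)) (x : X)
    (y : unitInterval) :
    ∑ i : Fin (m + 1), stopWeight (gradient s h π x) m i * potential s h (π ++ [⟨x, y, i⟩]) ≤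
      (1 + ε / m) * potential s h π := by
  simp only [potential_append hε hs]
  rw [Fin.sum_univ_eq_sum_range (fun i => stopWeight (gradient s h π x) m i *
    (potential s h π + s * (((y : ℝ) - (i : ℕ) / (m : ℝ)) * gradient s h π x i))) (m + 1)]
  simp only [mul_add, Finset.sum_add_distrib, ← Finset.sum_mul, sum_stopWeight]
  rcases hs0.eq_or_lt with h0 | h0
  -- The case `s = 0` arises from `B = 0`; it is separate because the bound on the gradient below
  -- divides by `s`.
  · have h1 : 0 ≤ ε * potential s h π :=
      (abs_nonneg _).trans (abs_mul_gradient_le hε hs π x 0)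
    subst h0
    simp only [zero_mul, mul_zero, Finset.sum_const_zero, add_zero, add_mul, one_mul]
    have h2 : 0 ≤ ε / m * potential 0 h π := by
      rw [div_mul_eq_mul_div]
      positivity
    linarith
  · have h1 := sum_stopWeight_mul_le (G := gradient s h π x) (M := ε * potential s h π / s) hm
      (fun k _ => by
        rw [le_div_iff₀ h0, ← abs_of_pos h0, ← abs_mul, mul_comm, abs_of_pos h0]
        exact abs_mul_gradient_le hε hs π x k) y.2.1 y.2.2
    have h2 := mul_le_mul_of_nonneg_left h1 h0.le
    rw [Finset.mul_sum] at h2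
    have h3 : s * (ε * potential s h π / s / m) = ε / m * potential s h π := by
      field_simp
    rw [h3] at h2
    have h4 : ∀ k ∈ Finset.range (m + 1), stopWeight (gradient s h π x) m k *
        (s * (((y : ℝ) - k / m) * gradient s h π x k)) =
        s * (stopWeight (gradient s h π x) m k *
          (((y : ℝ) - k / m) * gradient s h π x k)) := fun k _ => by ring
    rw [Finset.sum_congr rfl h4]
    linarith

/-! ### The multicalibration error and the potential -/

lemma sum_length_filter_forecast (π : List (Round X m)) :
    ∑ i : Fin (m + 1), ((π.filter (fun r => r.p = i)).length : ℝ) = π.length := by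
  induction π with
  | nil => simp
  | cons r l ih =>
    have h1 : ∀ i : Fin (m + 1), (((r :: l).filter (fun r => r.p = i)).length : ℝ) =
        (if r.p = i then 1 else 0) + ((l.filter (fun r => r.p = i)).length : ℝ) := by
      intro i
      by_cases hi : r.p = i <;> simp [hi, add_comm]
    simp only [h1, Finset.sum_add_distrib, ih]
    simp [add_comm]

lemma length_mul_multicalError (π : List (Round X m)) (h : X → ℝ) (hπ : 1 ≤ π.length) :
    π.length * multicalError π h =
      ∑ i : Fin (m + 1), |((π.filter (fun r => r.p = i)).map (fun r => r.residual h)).sum| := by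
  have h0 : (π.length : ℝ) ≠ 0 := by
    have : π.length ≠ 0 := by omega
    exact_mod_cast this
  rw [multicalError, ← Finset.mul_sum, ← mul_assoc, mul_one_div_cancel h0, one_mul]
  rfl

lemma multicalError_le_bound {h : X → ℝ} {B : ℝ} (hB : ∀ x, |h x| ≤ B) (π : List (Round X m))
    (hπ : 1 ≤ π.length) : multicalError π h ≤ B := by
  have h0 : (0 : ℝ) < π.length := by exact_mod_cast hπ
  refine le_of_mul_le_mul_left ?_ h0
  rw [length_mul_multicalError π h hπ, ← sum_length_filter_forecast, Finset.sum_mul]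
  refine Finset.sum_le_sum fun i _ => ?_
  induction π.filter (fun r => r.p = i) with
  | nil => simp
  | cons r l ih =>
    rw [List.map_cons, List.sum_cons, List.length_cons]
    have h1 := abs_add_le (r.residual h) (l.map (fun r => r.residual h)).sum
    have h2 := abs_residual_le hB r
    push_cast
    linarith

/-- At each grid point one of the two gamblers bets with the sign of the residual sum, and its
wealth is at most twice the mean; these factors `2` produce `(m + 1) * log 2`. -/
lemma mul_multicalError_le {h : X → ℝ} {s ε : ℝ} (hε : ε ≤ 1 / 2)
    (hs : ∀ x, |s * h x| ≤ ε) (π : List (Round X m)) (hπ : 1 ≤ π.length) :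
    s * (π.length * multicalError π h) ≤
      (m + 1) * Real.log 2 + Real.log (totalWealth s h π) + π.length * ε ^ 2 := by
  rw [length_mul_multicalError π h hπ, Finset.mul_sum, ← sum_length_filter_forecast,
    Finset.sum_mul, totalWealth, Real.log_prod fun p _ => (meanWealth_pos hε hs π p).ne',
    ← Fin.sum_univ_eq_sum_range (fun p => Real.log (meanWealth s h π p)) (m + 1)]
  have hc : ((m : ℝ) + 1) * Real.log 2 = ∑ _i : Fin (m + 1), Real.log 2 := by simp
  rw [hc, ← Finset.sum_add_distrib, ← Finset.sum_add_distrib]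
  refine Finset.sum_le_sum fun i _ => ?_
  have h1 := exp_le_wealth hε hs π i
  have h2 := exp_le_wealth hε (abs_neg_mul_le hs) π i
  have h3 := wealth_pos hε hs π i
  have h4 := wealth_pos hε (abs_neg_mul_le hs) π i
  simp only [← Fin.ext_iff] at h1 h2
  rw [← Real.log_mul two_ne_zero (meanWealth_pos hε hs π i).ne']
  have h5 : 2 * meanWealth s h π i = wealth s h π i + wealth (-s) h π i := by
    rw [meanWealth]
    ring
  rw [h5]
  have h6 := (Real.le_log_iff_exp_le (add_pos h3 h4)).2 (h1.trans (le_add_of_nonneg_right h4.le))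
  have h7 := (Real.le_log_iff_exp_le (add_pos h3 h4)).2 (h2.trans (le_add_of_nonneg_left h3.le))
  rcases abs_cases ((π.filter (fun r => r.p = i)).map (fun r => r.residual h)).sum with h8 | h8 <;>
  · rw [h8.1]
    linarith

/-! ### Expectations along a transcript -/

/-- Induction on the number of remaining rounds. The bound is affine in `Φ` because the weights sum
to `1`, so constants survive each draw; `c₁ = 0` covers bounds that hold on every transcript. -/
lemma expect_le_of_step {F : Forecaster X m} {A : Adversary X m} {g Φ : List (Round X m) → ℝ}
    {T : ℕ} {κ c₀ c₁ : ℝ} (hκ : 0 ≤ κ) (hc : 0 ≤ c₁)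
    (hF0 : ∀ π x, π.length < T → ∀ i, 0 ≤ F π x i)
    (hF1 : ∀ π x, π.length < T → ∑ i, F π x i = 1)
    (hΦ : ∀ π x y, π.length < T → ∑ i, F π x i * Φ (π ++ [⟨x, y, i⟩]) ≤ κ * Φ π)
    (hg : ∀ π, π.length = T → g π ≤ c₀ + c₁ * Φ π) (n : ℕ) :
    ∀ π, π.length + n = T → expect F A g n π ≤ c₀ + c₁ * (κ ^ n * Φ π) := by
  induction n with
  | zero =>
    intro π hπ
    simpa [expect] using hg π hπ
  | succ n ih =>
    intro π hπ
    have hlt : π.length < T := by omega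
    rw [expect]
    calc _ ≤ ∑ i, F π (A π).1 i * (c₀ + c₁ * (κ ^ n * Φ (π ++ [⟨(A π).1, (A π).2, i⟩]))) :=
          Finset.sum_le_sum fun i _ => mul_le_mul_of_nonneg_left
            (ih _ (by rw [List.length_append, List.length_singleton]; omega)) (hF0 π _ hlt i)
      _ = c₀ + c₁ * κ ^ n * ∑ i, F π (A π).1 i * Φ (π ++ [⟨(A π).1, (A π).2, i⟩]) := by
          rw [Finset.mul_sum]
          conv_rhs => rw [← one_mul c₀, ← hF1 π (A π).1 hlt, Finset.sum_mul,
            ← Finset.sum_add_distrib]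
          exact Finset.sum_congr rfl fun i _ => by ring
      _ ≤ c₀ + c₁ * κ ^ n * (κ * Φ π) := by
          have := mul_le_mul_of_nonneg_left (hΦ π (A π).1 (A π).2 hlt)
            (mul_nonneg hc (pow_nonneg hκ n))
          linarith
      _ = _ := by ring

/-! ### Reasoning about programs -/

/-- Executed from `s`, the command `c` takes at most `b` steps and ends in a state with `Q`. -/
def Cmd.Spec (o : ℕ → ℝ) (c : Cmd) (s : State) (b : ℕ) (Q : State → Prop) : Prop :=
  Q (c.exec o s).1 ∧ (c.exec o s).2 ≤ b

/-- The sequential composition of a list of commands. -/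
def Cmd.block : List Cmd → Cmd
  | [] => .skip
  | c :: l => .seq c (Cmd.block l)

lemma Cmd.Spec.mono {o : ℕ → ℝ} {c : Cmd} {s : State} {b b' : ℕ} {Q Q' : State → Prop}
    (h : c.Spec o s b Q) (hb : b ≤ b') (hQ : ∀ s', Q s' → Q' s') : c.Spec o s b' Q' :=
  ⟨hQ _ h.1, h.2.trans hb⟩

lemma Cmd.Spec.seq {o : ℕ → ℝ} {c c' : Cmd} {s : State} {b b' : ℕ} {Q R : State → Prop}
    (h : c.Spec o s b Q) (h' : ∀ s', Q s' → c'.Spec o s' b' R) :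
    (Cmd.seq c c').Spec o s (b + b') R :=
  ⟨(h' _ h.1).1, Nat.add_le_add h.2 (h' _ h.1).2⟩

lemma Cmd.Spec.ifLt {o : ℕ → ℝ} {x y : ℕ} {c c' : Cmd} {s : State} {b : ℕ} {Q : State → Prop}
    (h : s.rreg x < s.rreg y → c.Spec o s b Q) (h' : ¬ s.rreg x < s.rreg y → c'.Spec o s b Q) :
    (Cmd.ifLt x y c c').Spec o s (b + 1) Q := by
  unfold Cmd.Spec
  rw [Cmd.exec]
  by_cases hxy : s.rreg x < s.rreg y
  · simpa [Cmd.Spec, hxy] using h hxy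
  · simpa [Cmd.Spec, hxy] using h' hxy

lemma Cmd.Spec.loop {o : ℕ → ℝ} {i : ℕ} {c : Cmd} {s : State} {b n : ℕ} (I : ℕ → State → Prop)
    (hn : s.nreg i = n) (h0 : I 0 s)
    (hstep : ∀ k < n, ∀ s', I k s' → c.Spec o s' b (I (k + 1))) :
    (Cmd.loop i c).Spec o s (1 + n * (b + 1)) (I n) := by
  subst hn
  have key : ∀ k, k ≤ s.nreg i →
      I k ((fun q : State × ℕ => ((c.exec o q.1).1, q.2 + (c.exec o q.1).2 + 1))^[k] (s, 1)).1 ∧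
      ((fun q : State × ℕ => ((c.exec o q.1).1, q.2 + (c.exec o q.1).2 + 1))^[k] (s, 1)).2 ≤
        1 + k * (b + 1) := by
    intro k
    induction k with
    | zero => intro _; exact ⟨h0, by simp⟩
    | succ k ih =>
      intro hk
      obtain ⟨h1, h2⟩ := ih (by omega)
      obtain ⟨h3, h4⟩ := hstep k (by omega) _ h1
      rw [Function.iterate_succ_apply']
      refine ⟨h3, ?_⟩
      have : (k + 1) * (b + 1) = k * (b + 1) + (b + 1) := by ring
      dsimp only
      omega
  exact key _ le_rfl

/-! ### The program -/

/-- `r_4 := ∑ j < n_1, o j * mem_1[n_8 + j * n_5] * (1 + mem_2[j])`. -/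
def gradientCmd : Cmd :=
  .block [.addN 6 8 9, .setN 7 0, .castN 4 7,
    .loop 1 (.block [.query 5 7, .load 6 1 6, .mul 5 5 6, .load 6 2 7, .add 6 6 3, .mul 5 5 6,
      .add 4 4 5, .addN 6 6 5, .addN 7 7 4])]

/-- `r_11 := moveFraction r_7 r_4`. -/
def moveFractionCmd : Cmd :=
  .ifLt 9 7 (.ifLt 9 4 (.add 11 3 9) (.seq (.sub 11 7 4) (.div 11 7 11))) (.add 11 9 9)

/-- Moves on to the next grid point and fixes the weight of the previous one. -/
def scanCmd : Cmd :=
  .seq (.addN 8 8 4) (.seq gradientCmd (.seq moveFractionCmd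
    (.block [.mul 10 8 11, .sub 5 8 10, .subN 6 8 4, .store 0 6 5, .add 8 10 9, .add 7 4 9])))

/-- Writes the stopping weights of the scan of the gradient into `mem_0`. -/
def predictCmd : Cmd :=
  .seq (.setN 8 0) (.seq gradientCmd (.seq (.seq (.add 7 4 9) (.add 8 3 9))
    (.seq (.loop 2 scanCmd) (.store 0 2 8))))

/-- Updates the advantages in `mem_1` and the total wealths, decreased by `1`, in `mem_2`. -/
def learnCmd : Cmd :=
  .seq (.block [.castN 5 3, .castN 6 2, .div 5 5 6, .sub 5 1 5, .mul 10 5 2, .addN 6 3 9,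
      .setN 7 0])
    (.loop 1 (.block [.query 5 7, .mul 5 5 10, .load 6 1 6, .mul 4 5 6, .add 4 3 4, .add 6 6 5,
      .div 6 6 4, .store 1 6 6, .load 6 2 7, .add 6 6 3, .mul 6 6 4, .sub 6 6 3, .store 2 7 6,
      .addN 6 6 5, .addN 7 7 4]))

/-- Computes the least `m` with `T ≤ m ^ 3` and the betting fraction `1 / (2 m B)`. -/
def setupCmd : Cmd :=
  .seq (.block [.setN 4 1, .castN 3 4, .castN 6 0])
    (.seq (.loop 0 (.seq (.castN 5 2) (.seq (.mul 10 5 5) (.seq (.mul 10 10 5)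
        (.ifLt 10 6 (.addN 2 2 4) .skip)))))
      (.block [.addN 5 2 4, .castN 5 2, .add 5 5 5, .mul 5 5 0, .div 2 3 5]))

/-- The forecasting program. -/
def calibrator : Program := ⟨setupCmd, predictCmd, learnCmd⟩

/-- The contents of the registers that keep their values after the setup. -/
structure Ready (N m : ℕ) (η : ℝ) (s : State) : Prop where
  n1 : s.nreg 1 = N
  n2 : s.nreg 2 = m
  n4 : s.nreg 4 = 1
  n5 : s.nreg 5 = m + 1
  n9 : s.nreg 9 = 0
  r2 : s.rreg 2 = η
  r3 : s.rreg 3 = 1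
  r9 : s.rreg 9 = 0

/-- The gradient in terms of the values of the functions and the contents of the memory. -/
noncomputable def memGradient (N m : ℕ) (o : ℕ → ℝ) (μ : ℕ → ℕ → ℝ) (p : ℕ) : ℝ :=
  ∑ j ∈ Finset.range N, o j * μ 1 (p + j * (m + 1)) * (1 + μ 2 j)

/-- Natural numbers cannot be multiplied by the machine, so the address `p + j * (m + 1)` is
advanced by the stride `m + 1` held in `n_5`. Adding the zero register serves as a copy. -/
lemma gradientCmd_spec {N m : ℕ} {η : ℝ} (o : ℕ → ℝ) {s : State} (hs : Ready N m η s) :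
    gradientCmd.Spec o s (5 + 11 * N) fun s' => Ready N m η s' ∧ s'.mem = s.mem ∧
      s'.nreg 8 = s.nreg 8 ∧ s'.rreg 7 = s.rreg 7 ∧ s'.rreg 8 = s.rreg 8 ∧
      s'.rreg 4 = memGradient N m o s.mem (s.nreg 8) := by
  obtain ⟨h1, h2, h3, h4, h5, h6, h7, h8⟩ := hs
  have hl : ∀ s₀ : State, (Ready N m η s₀ ∧ s₀.mem = s.mem ∧
      s₀.nreg 8 = s.nreg 8 ∧ s₀.rreg 7 = s.rreg 7 ∧ s₀.rreg 8 = s.rreg 8 ∧ s₀.nreg 7 = 0 ∧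
      s₀.nreg 6 = s.nreg 8 ∧ s₀.rreg 4 = 0) →
      (Cmd.loop 1 (.block [.query 5 7, .load 6 1 6, .mul 5 5 6, .load 6 2 7, .add 6 6 3,
        .mul 5 5 6, .add 4 4 5, .addN 6 6 5, .addN 7 7 4])).Spec o s₀ (1 + N * (10 + 1)) fun s' =>
      (Ready N m η s' ∧ s'.mem = s.mem ∧ s'.nreg 8 = s.nreg 8 ∧ s'.rreg 7 = s.rreg 7 ∧
        s'.rreg 8 = s.rreg 8) ∧ s'.nreg 7 = N ∧ s'.nreg 6 = s.nreg 8 + N * (m + 1) ∧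
        s'.rreg 4 = memGradient N m o s.mem (s.nreg 8) := by
    rintro s₀ ⟨h0, hmem, hp, hr7, hr8, hj, ha, hr4⟩
    refine Cmd.Spec.loop (fun k s' =>
      (Ready N m η s' ∧ s'.mem = s.mem ∧ s'.nreg 8 = s.nreg 8 ∧ s'.rreg 7 = s.rreg 7 ∧
        s'.rreg 8 = s.rreg 8) ∧ s'.nreg 7 = k ∧ s'.nreg 6 = s.nreg 8 + k * (m + 1) ∧
        s'.rreg 4 = memGradient k m o s.mem (s.nreg 8)) h0.n1
      ⟨⟨h0, hmem, hp, hr7, hr8⟩, hj, by simp [ha], by simp [hr4, memGradient]⟩ ?_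
    rintro k - s' ⟨⟨⟨g1, g2, g3, g4, g5, g6, g7, g8⟩, gm, gp, gr7, gr8⟩, gj, ga, gr4⟩
    refine ⟨⟨⟨⟨?_, ?_, ?_, ?_, ?_, ?_, ?_, ?_⟩, ?_, ?_, ?_, ?_⟩, ?_, ?_, ?_⟩, ?_⟩ <;>
      simp [Cmd.block, Cmd.exec, State.setNat, State.setReal, *]
    · ring
    · rw [memGradient, memGradient, Finset.sum_range_succ]
      ring
  refine ((Cmd.Spec.seq (b := 1) ⟨rfl, le_rfl⟩ ?_ : Cmd.Spec o gradientCmd s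
    (1 + (1 + (1 + (1 + N * (10 + 1) + 1)))) _)).mono (by ring_nf; omega) fun s' h => h
  rintro _ rfl
  refine Cmd.Spec.seq (b := 1) ⟨rfl, le_rfl⟩ ?_
  rintro _ rfl
  refine Cmd.Spec.seq (b := 1) ⟨rfl, le_rfl⟩ ?_
  rintro _ rfl
  refine Cmd.Spec.seq (hl _ ?_) fun s' h' => ⟨?_, le_rfl⟩
  · refine ⟨⟨?_, ?_, ?_, ?_, ?_, ?_, ?_, ?_⟩, ?_, ?_, ?_, ?_, ?_, ?_, ?_⟩ <;>
      simp [Cmd.exec, State.setNat, State.setReal, *]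
  · obtain ⟨⟨g1, g2, g3, g4, g5⟩, -, -, g6⟩ := h'
    exact ⟨g1, g2, g3, g4, g5, g6⟩

lemma moveFractionCmd_spec {N m : ℕ} {η : ℝ} (o : ℕ → ℝ) {s : State} (hs : Ready N m η s) :
    moveFractionCmd.Spec o s 4
      fun s' => s' = s.setReal 11 (moveFraction (s.rreg 7) (s.rreg 4)) := by
  obtain ⟨-, -, -, -, -, -, h7, h8⟩ := hs
  unfold moveFractionCmd moveFraction Cmd.Spec
  simp only [Cmd.exec, h7, h8]
  split_ifs <;> simp [State.setReal]

/-- The scan overwrites `mem_0` while it reads the gradient, which depends only on `mem_1` and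
`mem_2`; hence the fixed reference memory `μ`. -/
lemma scanCmd_spec {N m k : ℕ} {η : ℝ} {G : ℕ → ℝ} (o : ℕ → ℝ) {s : State} {μ : ℕ → ℕ → ℝ}
    (hs : Ready N m η s) (hG : G = memGradient N m o μ) (h1 : s.mem 1 = μ 1)
    (h2 : s.mem 2 = μ 2) (hk : s.nreg 8 = k) (h7 : s.rreg 7 = G k) (h8 : s.rreg 8 = reach G k)
    (h0 : ∀ i < k, s.mem 0 i = reach G i - reach G (i + 1)) :
    scanCmd.Spec o s (20 + 11 * N) fun s' => Ready N m η s' ∧ s'.mem 1 = μ 1 ∧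
      s'.mem 2 = μ 2 ∧ s'.nreg 8 = k + 1 ∧ s'.rreg 7 = G (k + 1) ∧ s'.rreg 8 = reach G (k + 1) ∧
      ∀ i < k + 1, s'.mem 0 i = reach G i - reach G (i + 1) := by
  refine ((Cmd.Spec.seq (b := 1) ⟨rfl, le_rfl⟩ ?_ : Cmd.Spec o scanCmd s
    (1 + ((5 + 11 * N) + (4 + 7))) _)).mono (by omega) fun s' h => h
  rintro _ rfl
  refine Cmd.Spec.seq (gradientCmd_spec (N := N) (m := m) (η := η) o ?_) ?_
  · obtain ⟨g1, g2, g3, g4, g5, g6, g7, g8⟩ := hs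
    constructor <;> simp [Cmd.exec, State.setNat, *]
  rintro s' ⟨g, gm, gp, gr7, gr8, gr4⟩
  refine Cmd.Spec.seq (moveFractionCmd_spec o g) ?_
  rintro _ rfl
  obtain ⟨g1, g2, g3, g4, g5, g6, g7, g8⟩ := g
  have e4 := hs.n4
  have hmem : s'.mem = s.mem := gm
  have hp : s'.nreg 8 = k + 1 := by
    rw [gp]
    simp [Cmd.exec, State.setNat, hk, e4]
  have hr7 : s'.rreg 7 = G k := gr7.trans h7
  have hr8 : s'.rreg 8 = reach G k := gr8.trans h8
  have hr4 : s'.rreg 4 = G (k + 1) := by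
    rw [gr4, hG]
    simp [Cmd.exec, State.setNat, hk, e4, memGradient, h1, h2]
  clear gm gp gr7 gr8 gr4
  refine ⟨⟨⟨?_, ?_, ?_, ?_, ?_, ?_, ?_, ?_⟩, ?_, ?_, ?_, ?_, ?_, fun i hi => ?_⟩, ?_⟩ <;>
    simp [Cmd.block, Cmd.exec, State.setNat, State.setReal, State.setMem, reach, hp, hr7, hr8,
      hr4, hmem, g1, g2, g3, g4, g5, g6, g7, g8, h1, h2]
  rcases Nat.lt_succ_iff_lt_or_eq.1 hi with hi | rfl
  · rw [Function.update_of_ne hi.ne, h0 i hi]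
    rfl
  · simp

lemma predictCmd_spec {N m : ℕ} {η : ℝ} (o : ℕ → ℝ) {s : State} (hs : Ready N m η s) :
    predictCmd.Spec o s ((m + 1) * (21 + 11 * N)) fun s' => Ready N m η s' ∧
      s'.mem 1 = s.mem 1 ∧ s'.mem 2 = s.mem 2 ∧
      ∀ i ≤ m, s'.mem 0 i = stopWeight (memGradient N m o s.mem) m i := by
  set G := memGradient N m o s.mem with hG
  refine ((Cmd.Spec.seq (b := 1) ⟨rfl, le_rfl⟩ ?_ : Cmd.Spec o predictCmd s
    (1 + ((5 + 11 * N) + (2 + ((1 + m * (20 + 11 * N + 1)) + 1)))) _)).mono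
      (by ring_nf; omega) fun s' h => h
  rintro _ rfl
  refine Cmd.Spec.seq (gradientCmd_spec (N := N) (m := m) (η := η) o ?_) ?_
  · obtain ⟨g1, g2, g3, g4, g5, g6, g7, g8⟩ := hs
    constructor <;> simp [Cmd.exec, State.setNat, *]
  rintro s' ⟨⟨g1, g2, g3, g4, g5, g6, g7, g8⟩, gm, gp, -, -, gr4⟩
  have hmem : s'.mem = s.mem := gm
  have hp : s'.nreg 8 = 0 := by simp [gp, Cmd.exec, State.setNat]
  have hr4 : s'.rreg 4 = G 0 := by simp [gr4, hG, Cmd.exec, State.setNat]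
  clear gm gp gr4
  refine Cmd.Spec.seq (b := 2) (Q := fun s' => Ready N m η s' ∧ s'.mem 1 = s.mem 1 ∧
      s'.mem 2 = s.mem 2 ∧ s'.nreg 8 = 0 ∧ s'.rreg 7 = G 0 ∧ s'.rreg 8 = reach G 0 ∧
      ∀ i < 0, s'.mem 0 i = reach G i - reach G (i + 1)) ?_ ?_
  · refine ⟨⟨⟨?_, ?_, ?_, ?_, ?_, ?_, ?_, ?_⟩, ?_, ?_, ?_, ?_, ?_, ?_⟩, ?_⟩ <;>
      simp [Cmd.exec, State.setReal, reach, *]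
  rintro s₁ hs₁
  refine Cmd.Spec.seq (Cmd.Spec.loop (fun k s' => Ready N m η s' ∧ s'.mem 1 = s.mem 1 ∧
      s'.mem 2 = s.mem 2 ∧ s'.nreg 8 = k ∧ s'.rreg 7 = G k ∧ s'.rreg 8 = reach G k ∧
      ∀ i < k, s'.mem 0 i = reach G i - reach G (i + 1)) hs₁.1.n2 hs₁
      fun k _ s₂ ⟨f1, f2, f3, f4, f5, f6, f7⟩ => scanCmd_spec o f1 hG f2 f3 f4 f5 f6 f7) ?_
  rintro s₂ ⟨⟨f1, f2, f3, f4, f5, f6, f7, f8⟩, e1, e2, -, -, e5, e6⟩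
  refine ⟨⟨⟨?_, ?_, ?_, ?_, ?_, ?_, ?_, ?_⟩, ?_, ?_, fun i hi => ?_⟩, ?_⟩ <;>
    simp [Cmd.exec, State.setMem, *]
  rcases hi.lt_or_eq with hi | rfl
  · rw [Function.update_of_ne hi.ne, e6 i hi, stopWeight, if_neg hi.ne]
  · simp [stopWeight]

/-- Distinct pairs of a function and a forecast occupy distinct cells, so a store in `learnCmd`
leaves the other advantages intact. -/
lemma add_mul_succ_inj {m p q j k : ℕ} (hp : p ≤ m) (hq : q ≤ m) :
    p + j * (m + 1) = q + k * (m + 1) ↔ j = k ∧ p = q := by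
  constructor
  · intro h
    have h1 := congrArg (· % (m + 1)) h
    simp only [Nat.add_mul_mod_self_right] at h1
    rw [Nat.mod_eq_of_lt (by omega), Nat.mod_eq_of_lt (by omega)] at h1
    subst h1
    exact ⟨Nat.eq_of_mul_eq_mul_right (Nat.succ_pos m) (Nat.add_left_cancel h), rfl⟩
  · rintro ⟨rfl, rfl⟩
    rfl

lemma learnCmd_spec {N m p : ℕ} {η y : ℝ} (o : ℕ → ℝ) {s : State} (hs : Ready N m η s)
    (hp : s.nreg 3 = p) (hpm : p ≤ m) (hy : s.rreg 1 = y) :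
    learnCmd.Spec o s (9 + 17 * N) fun s' => Ready N m η s' ∧
      (∀ j < N, ∀ q ≤ m, s'.mem 1 (q + j * (m + 1)) = if p = q then
        (s.mem 1 (q + j * (m + 1)) + o j * ((y - p / m) * η)) /
          (1 + o j * ((y - p / m) * η) * s.mem 1 (q + j * (m + 1)))
        else s.mem 1 (q + j * (m + 1))) ∧
      ∀ j < N, s'.mem 2 j =
        (s.mem 2 j + 1) * (1 + o j * ((y - p / m) * η) * s.mem 1 (p + j * (m + 1))) - 1 := by
  set z : ℝ := (y - p / m) * η with hz
  set I : ℕ → State → Prop := fun k s' => Ready N m η s' ∧ s'.nreg 7 = k ∧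
      s'.nreg 6 = p + k * (m + 1) ∧ s'.rreg 10 = z ∧
      (∀ j, ∀ q ≤ m, s'.mem 1 (q + j * (m + 1)) = if j < k ∧ p = q then
        (s.mem 1 (q + j * (m + 1)) + o j * z) / (1 + o j * z * s.mem 1 (q + j * (m + 1)))
        else s.mem 1 (q + j * (m + 1))) ∧
      ∀ j, s'.mem 2 j = if j < k then
        (s.mem 2 j + 1) * (1 + o j * z * s.mem 1 (p + j * (m + 1))) - 1 else s.mem 2 j with hI
  have h1 := hs.n1
  have h2 := hs.n2
  have h3 := hs.n4
  have h4 := hs.n5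
  have h5 := hs.n9
  have h6 := hs.r2
  have h7 := hs.r3
  have h8 := hs.r9
  refine ((Cmd.Spec.seq (b := 8) (Q := I 0) ?_ fun s₀ hs₀ =>
    Cmd.Spec.loop (b := 16) (n := N) I hs₀.1.n1 hs₀ ?_ : Cmd.Spec o learnCmd s _ _)).mono
      (by ring_nf; omega) ?_
  · refine ⟨⟨⟨?_, ?_, ?_, ?_, ?_, ?_, ?_, ?_⟩, ?_, ?_, ?_, ?_, ?_⟩, ?_⟩ <;>
      simp [Cmd.block, Cmd.exec, State.setNat, State.setReal, *]
  · rintro k - s' ⟨⟨g1, g2, g3, g4, g5, g6, g7, g8⟩, gj, ga, gz, gm1, gm2⟩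
    have e1 : s'.mem 1 (p + k * (m + 1)) = s.mem 1 (p + k * (m + 1)) := by simp [gm1 k p hpm]
    have e2 : s'.mem 2 k = s.mem 2 k := by simp [gm2 k]
    clear_value z
    refine ⟨⟨⟨?_, ?_, ?_, ?_, ?_, ?_, ?_, ?_⟩, ?_, ?_, ?_, fun j q hq => ?_, fun j => ?_⟩, ?_⟩ <;>
      simp only [Cmd.block, Cmd.exec, State.setNat, State.setReal, State.setMem] <;>
      simp [g1, g2, g3, g4, g5, g6, g7, g8, gj, ga, gz, e1, e2]
    · ring
    · rw [Function.update_apply]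
      simp only [add_mul_succ_inj hq hpm]
      by_cases hjk : j = k ∧ q = p
      · obtain ⟨rfl, rfl⟩ := hjk
        simp
      · rw [if_neg hjk, gm1 j q hq]
        have : (j < k ∧ p = q) ↔ (j ≤ k ∧ p = q) := by
          constructor
          · rintro ⟨a, b⟩
            exact ⟨by omega, b⟩
          · rintro ⟨a, b⟩
            refine ⟨?_, b⟩
            by_contra hc
            exact hjk ⟨by omega, b.symm⟩
        simp only [this]
    · rw [Function.update_apply]
      by_cases hjk : j = k
      · subst hjk
        simp
      · rw [if_neg hjk, gm2 j]
        have : j < k ↔ j ≤ k := by omega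
        simp only [this]
  · rintro s' ⟨g, -, -, -, gm1, gm2⟩
    refine ⟨g, fun j hj q hq => ?_, fun j hj => ?_⟩
    · simp [gm1 j q hq, hj]
    · simp [gm2 j, hj]

lemma setupCmd_spec {T N : ℕ} (hT : 1 ≤ T) (B : ℝ) (o : ℕ → ℝ) :
    ∃ m : ℕ, 1 ≤ m ∧ T ≤ m ^ 3 ∧ (m - 1) ^ 3 < T ∧
      setupCmd.Spec o (initialState T N B) (11 + 8 * T)
        fun s' => Ready N m (1 / ((m + m) * B)) s' ∧ s'.mem = fun _ _ => 0 := by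
  set I : ℕ → State → Prop := fun k s' => (s'.nreg 1 = N ∧ s'.nreg 4 = 1 ∧
    s'.nreg 9 = 0 ∧ s'.rreg 0 = B ∧ s'.rreg 3 = 1 ∧ s'.rreg 6 = T ∧ s'.rreg 9 = 0 ∧
    s'.mem = fun _ _ => 0) ∧ (s'.nreg 2 = k ∨ T ≤ s'.nreg 2 ^ 3) ∧ (s'.nreg 2 - 1) ^ 3 < T with hI
  have h1 : (Cmd.block [.setN 4 1, .castN 3 4, .castN 6 0]).Spec o (initialState T N B) 4
      fun s' => s'.nreg 0 = T ∧ I 0 s' := by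
    refine ⟨⟨?_, ⟨?_, ?_, ?_, ?_, ?_, ?_, ?_, ?_⟩, ?_, ?_⟩, ?_⟩ <;>
      simp [Cmd.block, Cmd.exec, State.setNat, State.setReal, initialState]
    -- Truncated subtraction turns the last invariant at `m = 0` into `0 < T`.
    omega
  have h2 : ∀ s₀ : State, (s₀.nreg 0 = T ∧ I 0 s₀) →
      (Cmd.loop 0 (.seq (.castN 5 2) (.seq (.mul 10 5 5) (.seq (.mul 10 10 5)
        (.ifLt 10 6 (.addN 2 2 4) .skip))))).Spec o s₀ (1 + T * (5 + 1)) (I T) := by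
    rintro s₀ ⟨hT0, h0⟩
    refine Cmd.Spec.loop I hT0 h0 ?_
    rintro k - s' ⟨⟨g1, g2, g3, g4, g5, g6, g7, g8⟩, gm, gl⟩
    have hc : ((s'.nreg 2 : ℝ) * s'.nreg 2 * s'.nreg 2 < T) ↔ s'.nreg 2 ^ 3 < T := by
      rw [← Nat.cast_lt (α := ℝ)]
      push_cast
      ring_nf
    refine Cmd.Spec.seq (b := 1) (b' := 4) ⟨rfl, le_rfl⟩ ?_
    rintro _ rfl
    refine Cmd.Spec.seq (b := 1) (b' := 3) ⟨rfl, le_rfl⟩ ?_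
    rintro _ rfl
    refine Cmd.Spec.seq (b := 1) (b' := 2) ⟨rfl, le_rfl⟩ ?_
    rintro _ rfl
    refine Cmd.Spec.ifLt (b := 1) (fun h => ?_) fun h => ?_
    · have h' : s'.nreg 2 ^ 3 < T := by
        rw [← hc]
        simpa [Cmd.exec, State.setReal, g6] using h
      refine ⟨⟨⟨?_, ?_, ?_, ?_, ?_, ?_, ?_, ?_⟩, ?_, ?_⟩, ?_⟩ <;>
        simp [Cmd.exec, State.setReal, State.setNat, *]
      exact Or.inl (gm.resolve_right (not_le.2 h'))
    · have h' : ¬ s'.nreg 2 ^ 3 < T := by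
        rw [← hc]
        simpa [Cmd.exec, State.setReal, g6] using h
      refine ⟨⟨⟨?_, ?_, ?_, ?_, ?_, ?_, ?_, ?_⟩, Or.inr (not_lt.1 h'), gl⟩, le_rfl⟩ <;>
        simp [Cmd.exec, State.setReal, *]
  obtain ⟨m, hm⟩ : ∃ m, (Cmd.seq (Cmd.block [.setN 4 1, .castN 3 4, .castN 6 0])
      (Cmd.loop 0 (.seq (.castN 5 2) (.seq (.mul 10 5 5) (.seq (.mul 10 10 5)
        (.ifLt 10 6 (.addN 2 2 4) .skip)))))).Spec o (initialState T N B)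
      (4 + (1 + T * (5 + 1))) fun s' => I T s' ∧ s'.nreg 2 = m :=
    ⟨_, ⟨(h1.seq h2).1, rfl⟩, (h1.seq h2).2⟩
  have hm3 : T ≤ m ^ 3 ∧ (m - 1) ^ 3 < T := by
    obtain ⟨⟨⟨-, gm, gl⟩, rfl⟩, -⟩ := hm
    refine ⟨?_, gl⟩
    -- Running the search for `T` iterations is enough, since `T ≤ T ^ 3`.
    rcases gm with gm | gm
    · rw [gm]
      exact Nat.le_self_pow (by norm_num) T
    · exact gm
  have hm1 : 1 ≤ m := by
    rcases Nat.eq_zero_or_pos m with rfl | h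
    · have := hm3.1
      simp at this
      omega
    · exact h
  refine ⟨m, hm1, hm3.1, hm3.2, ?_⟩
  have h3 : ∀ s' : State, (I T s' ∧ s'.nreg 2 = m) →
      (Cmd.block [.addN 5 2 4, .castN 5 2, .add 5 5 5, .mul 5 5 0, .div 2 3 5]).Spec o s' 6
        fun s' => Ready N m (1 / ((m + m) * B)) s' ∧ s'.mem = fun _ _ => 0 := by
    rintro s' ⟨⟨⟨g1, g2, g3, g4, g5, g6, g7, g8⟩, -⟩, g9⟩
    clear hm h1 h2
    refine ⟨⟨⟨?_, ?_, ?_, ?_, ?_, ?_, ?_, ?_⟩, ?_⟩, ?_⟩ <;>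
      simp [Cmd.block, Cmd.exec, State.setNat, State.setReal, *]
  have h4 := hm.seq h3
  refine ⟨h4.1, ?_⟩
  have h5 := h4.2
  simp only [Cmd.exec, setupCmd] at h5 ⊢
  omega

variable {N : ℕ}

/-! ### Correctness and running time of the program -/

/-- The memory represents the wealth processes after the transcript `π`. -/
structure Represents (η : ℝ) (h : Fin N → X → ℝ) (π : List (Round X m)) (s : State) : Prop where
  ready : Ready N m η s
  mem1 : ∀ j : Fin N, ∀ p ≤ m, s.mem 1 (p + j * (m + 1)) = advantage η (h j) π p
  mem2 : ∀ j : Fin N, s.mem 2 j = totalWealth η (h j) π - 1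

lemma valuesAt_apply (h : Fin N → X → ℝ) (x : X) (j : Fin N) : valuesAt h x j = h j x := by
  simp [valuesAt]

lemma Represents.memGradient_eq {η : ℝ} {h : Fin N → X → ℝ} {π : List (Round X m)} {s : State}
    (hs : Represents η h π s) (x : X) {p : ℕ} (hp : p ≤ m) :
    memGradient N m (valuesAt h x) s.mem p = gradient η h π x p := by
  rw [memGradient, gradient, ← Fin.sum_univ_eq_sum_range
    (fun j => valuesAt h x j * s.mem 1 (p + j * (m + 1)) * (1 + s.mem 2 j)) N]
  refine Finset.sum_congr rfl fun j _ => ?_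
  rw [valuesAt_apply, hs.mem1 j p hp, hs.mem2 j]
  ring

lemma reach_congr {G G' : ℕ → ℝ} {k : ℕ} (h : ∀ i ≤ k, G i = G' i) : reach G k = reach G' k := by
  induction k with
  | zero => rfl
  | succ k ih =>
    rw [reach, reach, ih fun i hi => h i (by omega), h k (by omega), h (k + 1) le_rfl]

/-- Agreement can be required only up to `m`: beyond that, the program's address for the gradient
runs into the row of the next function. -/
lemma stopWeight_congr {G G' : ℕ → ℝ} {k : ℕ} (h : ∀ i ≤ m, G i = G' i) (hk : k ≤ m) :
    stopWeight G m k = stopWeight G' m k := by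
  unfold stopWeight
  split_ifs with hkm
  · exact reach_congr fun i hi => h i (by omega)
  · rw [reach_congr fun i hi => h i (by omega),
      reach_congr (k := k + 1) fun i hi => h i (by omega)]

lemma Represents.step {η ε : ℝ} {h : Fin N → X → ℝ} (hε : ε ≤ 1 / 2)
    (hη : ∀ j x, |η * h j x| ≤ ε) {π : List (Round X m)} {q : State × ℕ}
    (hs : Represents η h π q.1) (r : Round X m) :
    Represents η h (π ++ [r]) (calibrator.step h q r).1 ∧
      (calibrator.step h q r).2 ≤ q.2 + (m + 1) * (31 + 28 * N) := by
  obtain ⟨⟨f1, f2, f3, -⟩, fc⟩ := predictCmd_spec (valuesAt h r.x) hs.ready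
  set s₁ := (predictCmd.exec (valuesAt h r.x) q.1).1
  have g : Ready N m η ((s₁.setNat 3 r.p).setReal 1 r.y) := by
    obtain ⟨g1, g2, g3, g4, g5, g6, g7, g8⟩ := f1
    constructor <;> simp [State.setNat, State.setReal, *]
  obtain ⟨⟨e1, e2, e3⟩, ec⟩ := learnCmd_spec (p := r.p) (y := r.y) (valuesAt h r.x) g
    (by simp [State.setNat, State.setReal]) (Nat.lt_succ_iff.1 r.p.2) (by simp [State.setReal])
  have hz : ∀ j, h j r.x * (((r.y : ℝ) - (r.p : ℕ) / m) * η) = η * r.residual (h j) := by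
    intro j
    rw [Round.residual]
    ring
  have hm1 : ((s₁.setNat 3 r.p).setReal 1 r.y).mem 1 = q.1.mem 1 := f2
  have hm2 : ((s₁.setNat 3 r.p).setReal 1 r.y).mem 2 = q.1.mem 2 := f3
  rw [hm1] at e2 e3
  rw [hm2] at e3
  refine ⟨⟨e1, fun j p hp => ?_, fun j => ?_⟩, ?_⟩
  · refine (e2 j j.2 p hp).trans ?_
    rw [advantage_append hε (hη j), valuesAt_apply, hz, hs.mem1 j p hp]
  · refine (e3 j j.2).trans ?_
    rw [totalWealth_append hε (hη j), valuesAt_apply, hz, hs.mem1 j _ (Nat.lt_succ_iff.1 r.p.2),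
      hs.mem2 j]
    ring
  · have hc : (m + 1) * (31 + 28 * N) =
        (m + 1) * (21 + 11 * N) + (m + 1) + (9 + 17 * N) + m * (9 + 17 * N) := by ring
    change q.2 + (predictCmd.exec (valuesAt h r.x) q.1).2 + (m + 1) +
      (learnCmd.exec (valuesAt h r.x) ((s₁.setNat 3 r.p).setReal 1 r.y)).2 ≤ _
    rw [hc]
    have := Nat.zero_le (m * (9 + 17 * N))
    omega

lemma Represents.run {η ε B : ℝ} {h : Fin N → X → ℝ} {T b : ℕ} (hε : ε ≤ 1 / 2)
    (hη : ∀ j x, |η * h j x| ≤ ε)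
    (hstart : (calibrator.start T N B).1.mem = fun _ _ => 0)
    (hready : Ready N m η (calibrator.start T N B).1) (hb : (calibrator.start T N B).2 ≤ b)
    (π : List (Round X m)) :
    Represents η h π (calibrator.run T B h π).1 ∧
      (calibrator.run T B h π).2 ≤ b + π.length * ((m + 1) * (31 + 28 * N)) := by
  induction π using List.reverseRecOn with
  | nil =>
    -- All-zero memory encodes the empty transcript because the total wealths are stored decreased
    -- by `1`; no initialization of the arrays is needed.
    refine ⟨⟨hready, fun j p _ => ?_, fun j => ?_⟩, ?_⟩
    · simp [Program.run, hstart, advantage_nil]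
    · simp [Program.run, hstart, totalWealth_nil]
    · simpa [Program.run] using hb
  | append_singleton π r ih =>
    obtain ⟨h1, h2⟩ := ih.1.step hε hη r
    have hr : calibrator.run T B h (π ++ [r]) =
        calibrator.step h (calibrator.run T B h π) r := by
      simp [Program.run, List.foldl_append]
    rw [hr, List.length_append, List.length_singleton, Nat.add_mul, one_mul]
    exact ⟨h1, by have := ih.2; omega⟩

lemma Represents.forecaster_eq {η B : ℝ} {h : Fin N → X → ℝ} {T : ℕ} {π : List (Round X m)}
    (hs : Represents η h π (calibrator.run T B h π).1) (x : X) (i : Fin (m + 1)) :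
    calibrator.forecaster T B m h π x i = stopWeight (gradient η h π x) m i := by
  have hi : (i : ℕ) ≤ m := Nat.lt_succ_iff.1 i.2
  refine ((predictCmd_spec (valuesAt h x) hs.ready).1.2.2.2 i hi).trans ?_
  exact stopWeight_congr (fun p hp => hs.memGradient_eq x hp) hi

/-! ### The error bound -/

lemma multicalErrorClass_le {H : Finset (X → ℝ)} (hH : H.Nonempty) {N : ℕ} (e : Fin N ≃ H)
    {π : List (Round X m)} {a : ℝ} (ha : ∀ j, multicalError π (e j : X → ℝ) ≤ a) :
    multicalErrorClass π H hH ≤ a := by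
  refine Finset.sup'_le hH _ fun h hh => ?_
  simpa using ha (e.symm ⟨h, hh⟩)

/-- The error in terms of an affine function of the potential. -/
lemma mul_multicalError_le_potential {h : Fin N → X → ℝ} {s ε a : ℝ} (ha : 0 < a)
    (hε : ε ≤ 1 / 2) (hs : ∀ j x, |s * h j x| ≤ ε) (π : List (Round X m)) (hπ : 1 ≤ π.length)
    (j : Fin N) :
    s * (π.length * multicalError π (h j)) ≤
      (m + 1) + (Real.log a - 1) + π.length * ε ^ 2 + potential s h π / a := by
  have h1 := mul_multicalError_le hε (hs j) π hπ
  have h2 := totalWealth_pos hε (hs j) π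
  have h3 : totalWealth s (h j) π ≤ potential s h π :=
    Finset.single_le_sum (f := fun j => totalWealth s (h j) π)
      (fun i _ => (totalWealth_pos hε (hs i) π).le) (Finset.mem_univ j)
  have h4 : Real.log (totalWealth s (h j) π) ≤ Real.log (potential s h π) :=
    Real.log_le_log h2 h3
  have h5 : Real.log (potential s h π) = Real.log (potential s h π / a) + Real.log a := by
    rw [← Real.log_mul (div_pos (h2.trans_le h3) ha).ne' ha.ne', div_mul_cancel₀ _ ha.ne']
  have h6 := Real.log_le_sub_one_of_pos (div_pos (h2.trans_le h3) ha)
  have h7 : ((m : ℝ) + 1) * Real.log 2 ≤ m + 1 :=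
    mul_le_of_le_one_right (by positivity) (Real.log_two_lt_d9.le.trans (by norm_num))
  linarith

/-- The rate `T ^ (-1/3) * √L` dominates the error terms of the discretization `m ≈ T ^ (1/3)`. -/
lemma error_terms_le {m T : ℕ} {ℓ L : ℝ} (hT : 1 ≤ T) (hm : 1 ≤ m) (h1 : T ≤ m ^ 3)
    (h2 : (m - 1) ^ 3 < T) (hL : 1 ≤ L) (hℓ : ℓ ≤ L) (hLT : √L ≤ (T : ℝ) ^ (1 / 3 : ℝ)) :
    2 * m * (m + 1 + ℓ) / T + 1 / m + 1 / (2 * m) ≤ 18 * ((T : ℝ) ^ (-(1 / 3) : ℝ) * √L) := by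
  set τ : ℝ := (T : ℝ) ^ (1 / 3 : ℝ) with hτ
  have hT1 : (1 : ℝ) ≤ T := by exact_mod_cast hT
  have hm0 : (0 : ℝ) < m := by exact_mod_cast hm
  have hτ1 : 1 ≤ τ := Real.one_le_rpow hT1 (by norm_num)
  have hτ3 : τ ^ 3 = T := by
    rw [hτ, ← Real.rpow_natCast, ← Real.rpow_mul (by linarith)]
    norm_num
  have hinv : (T : ℝ) ^ (-(1 / 3) : ℝ) = τ⁻¹ := Real.rpow_neg (by linarith) _
  have hτm : τ ≤ m := by
    refine le_of_pow_le_pow_left₀ three_ne_zero hm0.le ?_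
    rw [hτ3]
    exact_mod_cast h1
  have hmτ : (m : ℝ) ≤ 2 * τ := by
    have h3 : (m : ℝ) - 1 < τ := by
      refine lt_of_pow_lt_pow_left₀ 3 (by linarith) ?_
      rw [hτ3]
      have : (((m - 1 : ℕ) ^ 3 : ℕ) : ℝ) < T := by exact_mod_cast h2
      rwa [Nat.cast_pow, Nat.cast_sub hm, Nat.cast_one] at this
    linarith
  set σ := √L with hσ
  have hσ1 : 1 ≤ σ := by
    rw [hσ, Real.one_le_sqrt]
    exact hL
  have hσ2 : L = σ * σ := (Real.mul_self_sqrt (by linarith)).symm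
  have hτ0 : 0 < τ := by linarith
  -- Here `hLT` enters: `L = σ * σ ≤ σ * τ`, while `m + 1 ≤ 3 * τ`.
  have t1 : (m : ℝ) + 1 + ℓ ≤ 4 * (σ * τ) := by
    have : τ ≤ σ * τ := le_mul_of_one_le_left hτ0.le hσ1
    have : L ≤ σ * τ := by rw [hσ2]; gcongr
    linarith
  have t2 : 2 * m * (m + 1 + ℓ) / T ≤ 16 * (τ⁻¹ * σ) := by
    rw [← hτ3, div_le_iff₀ (by positivity)]
    calc 2 * m * (m + 1 + ℓ) ≤ 2 * m * (4 * (σ * τ)) := by gcongr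
      _ ≤ 2 * (2 * τ) * (4 * (σ * τ)) := by gcongr
      _ = _ := by field_simp; ring
  have t3 : 1 / (m : ℝ) ≤ τ⁻¹ * σ := by
    rw [one_div]
    exact (inv_anti₀ hτ0 hτm).trans (le_mul_of_one_le_right (by positivity) hσ1)
  have t4 : 1 / (2 * (m : ℝ)) ≤ 1 / m := by
    apply one_div_le_one_div_of_le hm0
    linarith
  rw [hinv]
  linarith

lemma betting_fraction_mul_le {m : ℕ} {B : ℝ} {f : ℝ} (hm : 1 ≤ m) (hB : |f| ≤ B) :
    |1 / ((m + m) * B) * f| ≤ 1 / (2 * (m : ℝ)) := by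
  have hm0 : (0 : ℝ) < m := by exact_mod_cast hm
  have hB0 : 0 ≤ B := (abs_nonneg _).trans hB
  have hd : 0 ≤ ((m : ℝ) + m) * B := by positivity
  rw [abs_mul, abs_of_nonneg (one_div_nonneg.2 hd)]
  rcases hB0.eq_or_lt with h | h
  · rw [← h]
    simp
  · calc _ ≤ 1 / ((m + m) * B) * B := by gcongr
      _ = _ := by
        field_simp
        norm_num

lemma expect_multicalErrorClass_le {X : Type*} {H : Finset (X → ℝ)} (hH : H.Nonempty)
    {N m T : ℕ} {B η : ℝ} (hN : N = H.card) (e : Fin N ≃ H) (hT : 1 ≤ T) (hm : 1 ≤ m)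
    (hB : ∀ j x, |(e j : X → ℝ) x| ≤ B) (hη : η = 1 / ((m + m) * B))
    {F : Forecaster X m} (A : Adversary X m)
    (hF : ∀ π x, π.length < T → ∀ i,
      F π x i = stopWeight (gradient η (fun j => (e j : X → ℝ)) π x) m i) :
    expect F A (fun π => multicalErrorClass π H hH) T [] ≤ B ∧
      expect F A (fun π => multicalErrorClass π H hH) T [] ≤
        B * (2 * m * (m + 1 + Real.log N) / T + 1 / m + 1 / (2 * m)) := by
  set h : Fin N → X → ℝ := fun j => (e j : X → ℝ) with hh
  set ε : ℝ := 1 / (2 * (m : ℝ)) with hε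
  have hm1 : (1 : ℝ) ≤ m := by exact_mod_cast hm
  have hT0 : (0 : ℝ) < T := by exact_mod_cast hT
  have hε2 : ε ≤ 1 / 2 := by
    rw [hε]
    apply one_div_le_one_div_of_le two_pos
    linarith
  have hε0 : 0 < ε := by positivity
  have hN0 : 0 < N := by
    rw [hN]
    exact hH.card_pos
  have hN1 : (0 : ℝ) < N := by exact_mod_cast hN0
  -- The adversary's first context shows that `X` is inhabited; over an empty `X` nothing would
  -- prevent `B < 0`.
  have hB0 : 0 ≤ B := (abs_nonneg _).trans (hB ⟨0, hN0⟩ (A []).1)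
  have hη0 : 0 ≤ η := by
    rw [hη]
    positivity
  have hs : ∀ j x, |η * h j x| ≤ ε := fun j x => by
    rw [hη]
    exact betting_fraction_mul_le hm (hB j x)
  set κ : ℝ := 1 + ε / m with hκ
  have hκ0 : 0 < κ := by positivity
  have hF0 : ∀ π x, π.length < T → ∀ i, 0 ≤ F π x i := fun π x hπ i => by
    rw [hF π x hπ]
    exact stopWeight_nonneg _ _ _
  have hF1 : ∀ π x, π.length < T → ∑ i, F π x i = 1 := fun π x hπ => by
    simp only [hF π x hπ]
    rw [Fin.sum_univ_eq_sum_range (fun i => stopWeight (gradient η h π x) m i)]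
    exact sum_stopWeight _ _
  have hΦ : ∀ π x y, π.length < T → ∑ i, F π x i * potential η h (π ++ [⟨x, y, i⟩]) ≤
      κ * potential η h π := fun π x y hπ => by
    simp only [hF π x hπ]
    exact sum_stopWeight_mul_potential_le hη0 hm hε2 hs π x y
  have hbound : expect F A (fun π => multicalErrorClass π H hH) T [] ≤ B := by
    have := expect_le_of_step (A := A) (g := fun π => multicalErrorClass π H hH) (c₀ := B)
      (c₁ := 0) hκ0.le le_rfl hF0 hF1 hΦ
      (fun π hπ => by
        rw [zero_mul, add_zero]
        exact multicalErrorClass_le hH e fun j =>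
          multicalError_le_bound (hB j) π (by omega)) T [] (by simp)
    simpa using this
  refine ⟨hbound, ?_⟩
  -- For `B = 0` the betting fraction is `1 / 0 = 0` and the wealth argument is void, but the
  -- trivial bound `B` suffices.
  rcases hB0.eq_or_lt with hB' | hB'
  · rw [← hB', zero_mul]
    rwa [← hB'] at hbound
  -- The tangent to `log` is taken at the bound on the expected final potential, so the mean of
  -- `potential / a` is at most `1` and cancels the `-1`.
  set a : ℝ := N * κ ^ T with ha
  have ha0 : 0 < a := by positivity
  have hη1 : 0 < η := by
    rw [hη]
    positivity
  have hηT : 0 < η * T := by positivity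
  set c : ℝ := (m + 1) + (Real.log a - 1) + T * ε ^ 2 with hc
  have key := expect_le_of_step (A := A) (g := fun π => multicalErrorClass π H hH)
    (c₀ := c / (η * T)) (c₁ := 1 / (a * (η * T))) hκ0.le (by positivity) hF0 hF1 hΦ
    (fun π hπ => multicalErrorClass_le hH e fun j => by
      have h1 := mul_multicalError_le_potential ha0 hε2 hs π (by omega) j
      rw [hπ, ← mul_assoc, mul_comm] at h1
      have h2 := (le_div_iff₀ hηT).2 h1
      refine h2.trans_eq ?_
      rw [hc]
      field_simp) T [] (by simp)
  have hnil : potential η h ([] : List (Round X m)) = N := by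
    simp [potential, totalWealth_nil]
  refine key.trans ?_
  have hlog : Real.log a ≤ Real.log N + T * (ε / m) := by
    rw [ha, Real.log_mul hN1.ne' (pow_pos hκ0 T).ne', Real.log_pow]
    have h1 := Real.log_le_sub_one_of_pos hκ0
    have h2 : κ - 1 = ε / m := by
      rw [hκ]
      ring
    rw [h2] at h1
    gcongr
  rw [hnil]
  have e1 : 1 / (a * (η * T)) * (κ ^ T * N) = 1 / (η * T) := by
    rw [ha]
    field_simp
  rw [e1, ← add_div, div_le_iff₀ hηT]
  have e2 : B * (2 * m * (m + 1 + Real.log N) / T + 1 / m + 1 / (2 * m)) * (η * T) =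
      (m + 1) + Real.log N + T * (ε / m) + T * ε ^ 2 := by
    rw [hη, hε]
    field_simp
    ring
  rw [e2, hc]
  linarith

lemma one_le_log_six_mul {T N : ℕ} (hT : 1 ≤ T) (hN : 1 ≤ N) :
    1 ≤ Real.log (6 * T * N) ∧ Real.log N ≤ Real.log (6 * T * N) := by
  have hT1 : (1 : ℝ) ≤ T := by exact_mod_cast hT
  have hN1 : (1 : ℝ) ≤ N := by exact_mod_cast hN
  have h1 : (1 : ℝ) ≤ T * N := one_le_mul_of_one_le_of_one_le hT1 hN1
  constructor
  · rw [Real.le_log_iff_exp_le (by positivity)]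
    have := Real.exp_one_lt_d9
    linarith
  · apply Real.log_le_log (by linarith)
    have : (N : ℝ) ≤ T * N := le_mul_of_one_le_left (by linarith) hT1
    linarith

end OnlineMulticalibration

theorem theorem1 :
    ∃ (P : Program) (C : ℝ) (c k : ℕ),
      ∀ (X : Type*) (H : Finset (X → ℝ)) (hH : H.Nonempty) (B : ℝ),
        (∀ h ∈ H, ∀ x, |h x| ≤ B) →
      ∀ (e : Fin H.card ≃ H) (T : ℕ), 1 ≤ T →
      ∃ m : ℕ, 1 ≤ m ∧ P.discretization T H.card B = m ∧
        -- in every round the program outputs a probability distribution on the grid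
        (∀ (π : List (Round X m)) (x : X), π.length < T →
          (∀ i, 0 ≤ P.forecaster T B m (fun j => (e j : X → ℝ)) π x i) ∧
          ∑ i, P.forecaster T B m (fun j => (e j : X → ℝ)) π x i = 1) ∧
        -- expected multicalibration error against every adaptive adversary
        (∀ A : Adversary X m,
          expect (P.forecaster T B m (fun j => (e j : X → ℝ))) A
              (fun π => multicalErrorClass π H hH) T [] ≤
            C * (B * (T : ℝ) ^ (-(1 / 3) : ℝ) * √(Real.log (6 * T * H.card)))) ∧
        -- total running time
        (∀ π : List (Round X m), π.length = T →
          (P.run T B (fun j => (e j : X → ℝ)) π).2 ≤ c * H.card * T ^ k) := by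
  refine ⟨calibrator, 18, 200, 2, fun X H hH B hB e T hT => ?_⟩
  obtain ⟨m, hm, h1, h2, ⟨h3, h4⟩, h5⟩ := setupCmd_spec (N := H.card) hT B (fun _ => 0)
  have hBe : ∀ j x, |(e j : X → ℝ) x| ≤ B := fun j x => hB _ (e j).2 x
  have hN : 1 ≤ H.card := hH.card_pos
  have hm1 : (1 : ℝ) ≤ m := by exact_mod_cast hm
  have hT1 : (1 : ℝ) ≤ T := by exact_mod_cast hT
  have hε : 1 / (2 * (m : ℝ)) ≤ 1 / 2 := by
    apply one_div_le_one_div_of_le two_pos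
    linarith
  have hrun := fun π : List (Round X m) => Represents.run (h := fun j => (e j : X → ℝ)) hε
    (fun j x => betting_fraction_mul_le hm (hBe j x)) h4 h3 h5 π
  have hF : ∀ (π : List (Round X m)) x i,
      calibrator.forecaster T B m (fun j => (e j : X → ℝ)) π x i =
        stopWeight (gradient (1 / ((m + m) * B)) (fun j => (e j : X → ℝ)) π x) m i :=
    fun π x i => (hrun π).1.forecaster_eq x i
  refine ⟨m, hm, h3.n2, fun π x _ => ⟨fun i => ?_, ?_⟩, fun A => ?_, fun π hπ => ?_⟩
  · rw [hF]
    exact stopWeight_nonneg _ _ _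
  · simp only [hF]
    rw [Fin.sum_univ_eq_sum_range (fun i => stopWeight (gradient (1 / ((m + m) * B))
      (fun j => (e j : X → ℝ)) π x) m i)]
    exact sum_stopWeight _ _
  · obtain ⟨h6, h7⟩ := expect_multicalErrorClass_le hH rfl e hT hm hBe rfl A fun π x _ => hF π x
    obtain ⟨hL, hNL⟩ := one_le_log_six_mul hT hN
    have hB0 : 0 ≤ B := (abs_nonneg _).trans (hBe ⟨0, hN⟩ (A []).1)
    set L := Real.log (6 * T * H.card)
    -- If `√L` exceeds `T ^ (1/3)`, the claimed rate is at least `1` and the trivial bound `B` is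
    -- enough.
    rcases le_total (√L) ((T : ℝ) ^ (1 / 3 : ℝ)) with h | h
    · refine h7.trans ?_
      have := mul_le_mul_of_nonneg_left (error_terms_le hT hm h1 h2 hL hNL h) hB0
      linarith
    · refine h6.trans ?_
      have hτ : 0 < (T : ℝ) ^ (1 / 3 : ℝ) := Real.rpow_pos_of_pos (by linarith) _
      have h8 : 1 ≤ (T : ℝ) ^ (-(1 / 3) : ℝ) * √L := by
        rw [Real.rpow_neg (by linarith), inv_mul_eq_div, one_le_div hτ]
        exact h
      have h9 := le_mul_of_one_le_right hB0 h8
      linarith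
  · refine (hrun π).2.trans ?_
    -- By minimality of `m`: otherwise `T ^ 3 ≤ (m - 1) ^ 3 < T`.
    have hmT : m ≤ T := by
      by_contra hlt
      have h6 : T ≤ m - 1 := by omega
      have h7 : T ^ 3 < T := (Nat.pow_le_pow_left h6 3).trans_lt h2
      exact absurd (Nat.le_self_pow three_ne_zero T) (not_le.2 h7)
    rw [hπ]
    calc 11 + 8 * T + T * ((m + 1) * (31 + 28 * H.card))
        ≤ 19 * (H.card * T ^ 2) + T * ((T + T) * (59 * H.card)) := by
          have h6 : T ≤ H.card * T ^ 2 :=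
            (Nat.le_self_pow two_ne_zero T).trans (Nat.le_mul_of_pos_left _ hN)
          have h7 : (m + 1) * (31 + 28 * H.card) ≤ (T + T) * (59 * H.card) :=
            Nat.mul_le_mul (by omega) (by omega)
          have h8 := Nat.mul_le_mul_left T h7
          omega
      _ = 137 * (H.card * T ^ 2) := by ring
      _ ≤ 200 * (H.card * T ^ 2) := by omega
      _ = 200 * H.card * T ^ 2 := by ring
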